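/- Let $m,n$ be natural numbers and, for $i\in[m]=\{1,\dots,m\}$, let $f_i(x)=x^{\top}A_ix+2b_i^{\top}x+c_i$ be a quadratic function on $\mathbb{R}^n$ with $A_i\in\{I_n,-I_n,0\}$, $b_i\in\mathbb{R}^n$, $c_i\in\mathbb{R}$. Put $P=\{i:A_i=I_n\}$, $N=\{i:A_i=-I_n\}$, $Z=\{i:A_i=0\}$, let $S=\{x\in\mathbb{R}^n: f_i(x)<0 \text{ for all } i\in[m]\}$, and let $$Q_i=\begin{bmatrix}A_i&b_i\\ b_i^{\top}&c_i\end{bmatrix},\qquad Q_\lambda=\sum_{i=1}^m\lambda_iQ_i\quad(\lambda\in\mathbb{R}^m).$$ For a nonzero $\lambda\in\mathbb{R}^m_{\ge 0}$, the aggregation of the constraints with weights $\lambda$ is the inequality $\sum_{i=1}^m\lambda_if_i(x)<0$; its solution set is $S_\lambda=\{x\in\mathbb{R}^n:\sum_{i=1}^m\lambda_if_i(x)<0\}$. Assume that one of the following holds: - $\dim\operatorname{span}(Q_1,\dots,Q_m)\le n-1$; - $\dim\operatorname{span}(Q_1,\dots,Q_m)=n$ and the PDLC (positive definite linear combination) condition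 holds, i.e. $Q_\theta\succ0$ for some $\theta\in\mathbb{R}^m$. Then: 1. $S=\emptyset$ if and only if $Q_\lambda\succeq0$ for some nonzero $\lambda\in\mathbb{R}^m_{\ge0}$. 2. $\operatorname{conv}(S)\ne\mathbb{R}^n$ if and only if $P\neq\emptyset$ or there is $i\in Z$ such that either $b_i\ne0$, or $b_i=0$ and $c_i\ge0$. 3. If $\emptyset\subsetneq\operatorname{conv}(S)\subsetneq\mathbb{R}^n$, then $\operatorname{conv}(S)$ is described by at most $|P||N|+|P|+|Z|$ aggregations: there is a finite set $\Lambda$ of nonzero vectors in $\mathbb{R}^m_{\ge0}$ with $|\Lambda|\le|P||N|+|P|+|Z|$ and $\operatorname{conv}(S)=\bigcap_{\lambda\in\Lambda}S_\lambda$. -/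

import Mathlib

/-- The data `(A, b, c)` of a quadratic function `x ↦ xᵀ A x + 2 bᵀ x + c` on `ℝⁿ`. -/
structure QuadFun (n : ℕ) where
  A : Matrix (Fin n) (Fin n) ℝ
  b : Fin n → ℝ
  c : ℝ

namespace QuadFun

/-- The value `xᵀ A x + 2 bᵀ x + c`. -/
def eval {n : ℕ} (f : QuadFun n) (x : Fin n → ℝ) : ℝ :=
  dotProduct x (f.A.mulVec x) + 2 * dotProduct f.b x + f.c

/-- The `(n + 1) × (n + 1)` matrix `[[A, b], [bᵀ, c]]`. -/
def Q {n : ℕ} (f : QuadFun n) : Matrix (Fin n ⊕ Unit) (Fin n ⊕ Unit) ℝ :=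
  Matrix.fromBlocks f.A (Matrix.replicateCol Unit f.b) (Matrix.replicateRow Unit f.b)
    (Matrix.of fun _ _ => f.c)

/-- The set `S` cut out by the strict inequalities `f i x < 0` for all `i`. -/
def feasibleSet {n m : ℕ} (f : Fin m → QuadFun n) : Set (Fin n → ℝ) :=
  {x | ∀ i, (f i).eval x < 0}

/-- The aggregated matrix `Q_l = ∑ i, l i • Q i`. -/
def aggMatrix {n m : ℕ} (f : Fin m → QuadFun n) (l : Fin m → ℝ) :
    Matrix (Fin n ⊕ Unit) (Fin n ⊕ Unit) ℝ :=
  ∑ i, l i • (f i).Q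

/-- The set `S_l` cut out by the single aggregated inequality `∑ i, l i * f i x < 0`. -/
def aggSet {n m : ℕ} (f : Fin m → QuadFun n) (l : Fin m → ℝ) : Set (Fin n → ℝ) :=
  {x | ∑ i, l i * (f i).eval x < 0}

/-- Positive definite linear combination: some real linear combination of the matrices `Q i`,
with coefficients of any sign, is positive definite. -/
def PDLC {n m : ℕ} (f : Fin m → QuadFun n) : Prop :=
  ∃ θ : Fin m → ℝ, (aggMatrix f θ).PosDef

/-- The dimension of the linear span of the matrices `Q i`. -/
noncomputable def spanDim {n m : ℕ} (f : Fin m → QuadFun n) : ℕ :=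
  Module.finrank ℝ (Submodule.span ℝ (Set.range fun i => (f i).Q))

/-- The indices `i` with `A i = I`. -/
def idxP {n m : ℕ} (f : Fin m → QuadFun n) : Set (Fin m) := {i | (f i).A = 1}

/-- The indices `i` with `A i = -I`. -/
def idxN {n m : ℕ} (f : Fin m → QuadFun n) : Set (Fin m) := {i | (f i).A = -1}

/-- The indices `i` with `A i = 0`. -/
def idxZ {n m : ℕ} (f : Fin m → QuadFun n) : Set (Fin m) := {i | (f i).A = 0}

end QuadFun

open Matrix

/-! Replace `xᵀx` by a variable `s`: each `f i` becomes affine in `(s, x)`, and `S` is cut out on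
the paraboloid `xᵀx = s`. The claim is that `conv S` is the projection of the convex set where `xᵀx
≤ s` and all lifted inequalities hold (`convexHull_feasibleSet_eq`). The dimension hypothesis
supplies a direction `(σ, u)` with `u ≠ 0` that leaves every lifted function constant; a point
inside the paraboloid, moved both ways along it, exits at two points of `S` whose segment contains
it.

Eliminating `s` (`exists_lift_iff`) leaves inequalities indexed by `P`, `Z` and `P × N`, which are
the aggregations of part 3 and give part 2. For part 1, if `S` is empty then the lifted convex
system is infeasible, and separation yields multipliers whose aggregation is positive semidefinite.
-/

/-- A quadratic polynomial with positive leading and nonpositive constant coefficient has a root on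
each side of zero. -/
lemma exists_roots_of_constant_nonpos {p k : ℝ} (q : ℝ) (hp : 0 < p) (hk : k ≤ 0) :
    ∃ r t : ℝ, r ≤ 0 ∧ 0 ≤ t ∧ p * r ^ 2 + q * r + k = 0 ∧ p * t ^ 2 + q * t + k = 0 := by
  have hpk : 0 ≤ p * -k := mul_nonneg hp.le (by linarith)
  have hD : 0 ≤ q ^ 2 - 4 * p * k := by nlinarith [sq_nonneg q]
  have habs : |q| ≤ √(q ^ 2 - 4 * p * k) := Real.abs_le_sqrt (by linarith)
  have hsq := Real.sq_sqrt hD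
  set d := √(q ^ 2 - 4 * p * k)
  obtain ⟨h1, h2⟩ := abs_le.1 habs
  refine ⟨(-q - d) / (2 * p), (-q + d) / (2 * p), ?_, ?_, ?_, ?_⟩
  · exact div_nonpos_of_nonpos_of_nonneg (by linarith) (by linarith)
  · exact div_nonneg (by linarith) (by linarith)
  · field_simp
    linear_combination hsq
  · field_simp
    linear_combination hsq

lemma dotProduct_self_nonneg_real {n : ℕ} (x : Fin n → ℝ) : 0 ≤ x ⬝ᵥ x :=
  Finset.sum_nonneg fun i _ => mul_self_nonneg (x i)

lemma dotProduct_self_pos_real {n : ℕ} {x : Fin n → ℝ} (hx : x ≠ 0) : 0 < x ⬝ᵥ x :=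
  lt_of_le_of_ne (dotProduct_self_nonneg_real x) fun h => hx (dotProduct_self_eq_zero.1 h.symm)

/-- The solid paraboloid `{(s, x) | |x|² ≤ s}` is convex. -/
lemma dotProduct_self_convexComb_le {n : ℕ} {x y : Fin n → ℝ} {s t p q : ℝ} (hs : x ⬝ᵥ x ≤ s)
    (ht : y ⬝ᵥ y ≤ t) (hp : 0 ≤ p) (hq : 0 ≤ q) (hpq : p + q = 1) :
    (p • x + q • y) ⬝ᵥ (p • x + q • y) ≤ p * s + q * t := by
  have h := mul_nonneg (mul_nonneg hp hq) (dotProduct_self_nonneg_real (x - y))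
  simp only [dotProduct_add, add_dotProduct, dotProduct_smul, smul_dotProduct, smul_eq_mul,
    dotProduct_sub, sub_dotProduct, dotProduct_comm y x] at h ⊢
  obtain rfl : q = 1 - p := by linarith
  nlinarith [mul_le_mul_of_nonneg_left hs hp, mul_le_mul_of_nonneg_left ht hq]

namespace QuadFun

variable {n m : ℕ}

/-! ### The lift and its constant directions -/

/-- The function `a s + 2 bᵀ x + c`, which is `f` with `xᵀ A x` replaced by `a s`. -/
def affineLift (f : QuadFun n) (a s : ℝ) (x : Fin n → ℝ) : ℝ :=
  a * s + 2 * (f.b ⬝ᵥ x) + f.c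

lemma eval_eq_affineLift {f : QuadFun n} {a : ℝ} (ha : f.A = a • 1) (x : Fin n → ℝ) :
    f.eval x = f.affineLift a (x ⬝ᵥ x) x := by
  simp [eval, affineLift, ha, smul_mulVec]

lemma affineLift_convexComb (f : QuadFun n) (a s t : ℝ) (x y : Fin n → ℝ) {p q : ℝ}
    (hpq : p + q = 1) :
    f.affineLift a (p * s + q * t) (p • x + q • y) =
      p * f.affineLift a s x + q * f.affineLift a t y := by
  simp only [affineLift, dotProduct_add, dotProduct_smul, smul_eq_mul]
  linear_combination -(f.c) * hpq

/-- The pairing of a direction `(σ, u)` with a symmetric block matrix. -/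
def directionPairing (k : Fin n) :
    (ℝ × (Fin n → ℝ)) →ₗ[ℝ] Matrix (Fin n ⊕ Unit) (Fin n ⊕ Unit) ℝ →ₗ[ℝ] ℝ :=
  LinearMap.mk₂ ℝ
    (fun v M => M (Sum.inl k) (Sum.inl k) * v.1 + 2 * ∑ j, M (Sum.inl j) (Sum.inr ()) * v.2 j)
    (fun v w M => by simp [mul_add, Finset.sum_add_distrib]; ring)
    (fun r v M => by
      simp only [Prod.smul_fst, Prod.smul_snd, Pi.smul_apply, smul_eq_mul, mul_add,
        Finset.mul_sum]
      congr 1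
      · ring
      · exact Finset.sum_congr rfl fun j _ => by ring)
    (fun v M N => by simp [add_mul, Finset.sum_add_distrib]; ring)
    (fun r v M => by
      simp only [Matrix.smul_apply, smul_eq_mul, mul_add, Finset.mul_sum]
      congr 1
      · ring
      · exact Finset.sum_congr rfl fun j _ => by ring)

lemma directionPairing_Q {f : QuadFun n} {a : ℝ} (ha : f.A = a • 1) (k : Fin n)
    (v : ℝ × (Fin n → ℝ)) : directionPairing k v f.Q = a * v.1 + 2 * (f.b ⬝ᵥ v.2) := by
  simp [directionPairing, Q, ha, dotProduct]

/-- A direction along which every lifted function is constant and which is not vertical. -/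
lemma exists_constant_direction {f : Fin m → QuadFun n} {a : Fin m → ℝ}
    (ha : ∀ i, (f i).A = a i • 1)
    (hdim : spanDim f + 1 ≤ n ∨ (spanDim f = n ∧ PDLC f)) :
    ∃ (σ : ℝ) (u : Fin n → ℝ), u ≠ 0 ∧ ∀ i, a i * σ + 2 * ((f i).b ⬝ᵥ u) = 0 := by
  have hn : 0 < n := by
    rcases hdim with h | ⟨h, θ, hθ⟩
    · omega
    · rcases Nat.eq_zero_or_pos n with rfl | h0
      · have hbot : Submodule.span ℝ (Set.range fun i => (f i).Q) = ⊥ :=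
          Submodule.finrank_eq_zero.1 h
        have hQ : ∀ i, (f i).Q = 0 := fun i => by
          have : (f i).Q ∈ Submodule.span ℝ (Set.range fun i => (f i).Q) :=
            Submodule.subset_span ⟨i, rfl⟩
          rwa [hbot, Submodule.mem_bot] at this
        have := hθ.diag_pos (i := Sum.inr ())
        simp [aggMatrix, hQ] at this
      · exact h0
  let k : Fin n := ⟨0, hn⟩
  let W := Submodule.span ℝ (Set.range fun i => (f i).Q)
  -- Testing directions against `W` bounds the rank by `spanDim f`, so a kernel appears by counting
  -- dimensions.
  let T : (ℝ × (Fin n → ℝ)) →ₗ[ℝ] Module.Dual ℝ W :=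
    (LinearMap.lcomp ℝ ℝ W.subtype).comp (directionPairing k)
  have hT : ∀ v, T v = 0 → ∀ i, a i * v.1 + 2 * ((f i).b ⬝ᵥ v.2) = 0 := fun v hv i => by
    rw [← directionPairing_Q (ha i) k]
    exact LinearMap.congr_fun hv ⟨(f i).Q, Submodule.subset_span ⟨i, rfl⟩⟩
  have hW : Module.finrank ℝ (Module.Dual ℝ W) = spanDim f := Subspace.dual_finrank_eq
  rcases hdim with h | ⟨h, θ, hθ⟩
  -- Here `n` dimensions suffice, so `σ = 0` can be imposed and `u ≠ 0` is automatic.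
  · have hker : LinearMap.ker (T.comp (LinearMap.inr ℝ ℝ (Fin n → ℝ))) ≠ ⊥ :=
      LinearMap.ker_ne_bot_of_finrank_lt (by rw [hW]; simpa using h)
    obtain ⟨u, hu, hu0⟩ := Submodule.exists_mem_ne_zero_of_ne_bot hker
    exact ⟨0, u, hu0, hT (0, u) hu⟩
  · have hker : LinearMap.ker T ≠ ⊥ :=
      LinearMap.ker_ne_bot_of_finrank_lt (by rw [hW, h]; simp)
    obtain ⟨⟨σ, u⟩, hv, hv0⟩ := Submodule.exists_mem_ne_zero_of_ne_bot hker
    refine ⟨σ, u, ?_, hT _ hv⟩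
    rintro rfl
    -- A vertical kernel vector would force every `a i = 0`, so no combination could have a positive
    -- `(k, k)` entry, against PDLC.
    have hσ : σ ≠ 0 := fun h0 => hv0 (by simp [h0])
    have ha0 : ∀ i, a i = 0 := fun i => by simpa [hσ] using hT _ hv i
    have := hθ.diag_pos (i := Sum.inl k)
    simp [aggMatrix, Q, ha, ha0, Matrix.sum_apply] at this

/-! ### The convex hull as a projection -/

lemma convexHull_feasibleSet_eq {f : Fin m → QuadFun n} {a : Fin m → ℝ}
    (ha : ∀ i, (f i).A = a i • 1)
    (hdim : spanDim f + 1 ≤ n ∨ (spanDim f = n ∧ PDLC f)) :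
    convexHull ℝ (feasibleSet f) =
      {x | ∃ s, x ⬝ᵥ x ≤ s ∧ ∀ i, (f i).affineLift (a i) s x < 0} := by
  apply Set.Subset.antisymm
  · apply convexHull_min
    · exact fun x hx => ⟨_, le_rfl, fun i => eval_eq_affineLift (ha i) x ▸ hx i⟩
    · rintro x ⟨s, hs, hx⟩ y ⟨t, ht, hy⟩ p q hp hq hpq
      refine ⟨_, dotProduct_self_convexComb_le hs ht hp hq hpq, fun i => ?_⟩
      rw [affineLift_convexComb _ _ _ _ _ _ hpq]
      rcases hp.eq_or_lt with rfl | hp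
      · obtain rfl : q = 1 := by linarith
        simpa using hy i
      · exact add_neg_of_neg_of_nonpos (mul_neg_of_pos_of_neg hp (hx i))
          (mul_nonpos_of_nonneg_of_nonpos hq (hy i).le)
  · rintro x ⟨s, hs, hx⟩
    obtain ⟨σ, u, hu, hdir⟩ := exists_constant_direction ha hdim
    -- The roots in `t` of `|x + t u|² = s + t σ`: where the line meets the paraboloid.
    obtain ⟨r, t, hr, ht, hr0, ht0⟩ := exists_roots_of_constant_nonpos (2 * (x ⬝ᵥ u) - σ)
      (dotProduct_self_pos_real hu) (sub_nonpos.2 hs)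
    have key : ∀ t : ℝ, u ⬝ᵥ u * t ^ 2 + (2 * (x ⬝ᵥ u) - σ) * t + (x ⬝ᵥ x - s) = 0 →
        AffineMap.lineMap x (x + u) t ∈ convexHull ℝ (feasibleSet f) := fun t h0 => by
      apply subset_convexHull
      intro i
      have hi := hx i
      rw [eval_eq_affineLift (ha i)]
      simp only [AffineMap.lineMap_apply, vsub_eq_sub, vadd_eq_add, add_sub_cancel_left,
        affineLift, dotProduct_add, add_dotProduct, dotProduct_smul, smul_dotProduct,
        smul_eq_mul, dotProduct_comm u x] at hi ⊢
      linear_combination hi + a i * h0 + t * hdir i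
    have hconv := ((convex_convexHull ℝ (feasibleSet f)).affine_preimage
      (AffineMap.lineMap x (x + u) : ℝ →ᵃ[ℝ] _)).ordConnected.out (key r hr0) (key t ht0) ⟨hr, ht⟩
    simpa using hconv

/-! ### Fourier–Motzkin elimination of the lifted variable -/

/-- Eliminating `s` from the lifted description. -/
lemma exists_lift_iff {f : Fin m → QuadFun n} {a : Fin m → ℝ}
    (ha : ∀ i, a i = 1 ∨ a i = -1 ∨ a i = 0) (x : Fin n → ℝ) :
    (∃ s, x ⬝ᵥ x ≤ s ∧ ∀ i, (f i).affineLift (a i) s x < 0) ↔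
      (∀ i, a i = 1 → (f i).affineLift 1 (x ⬝ᵥ x) x < 0) ∧
      (∀ i, a i = 0 → (f i).affineLift 0 (x ⬝ᵥ x) x < 0) ∧
      ∀ i j, a i = 1 → a j = -1 →
        (f i).affineLift 1 (x ⬝ᵥ x) x + (f j).affineLift (-1) (x ⬝ᵥ x) x < 0 := by
  simp only [affineLift]
  constructor
  · rintro ⟨s, hs, h⟩
    refine ⟨fun i hi => ?_, fun i hi => ?_, fun i j hi hj => ?_⟩
    · have := h i
      rw [hi] at this
      linarith
    · have := h i
      rw [hi] at this
      linarith
    · have h1 := h i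
      have h2 := h j
      rw [hi] at h1
      rw [hj] at h2
      linarith
  · rintro ⟨hP, hZ, hPN⟩
    let lo : Fin m → ℝ := fun j => 2 * ((f j).b ⬝ᵥ x) + (f j).c
    -- The least upper bound on `s` is compared with the greatest lower bound.
    obtain ⟨s, hlo, hup⟩ := Order.exists_between_finsets
      (insert (x ⬝ᵥ x) ((Finset.univ.filter fun j => a j = -1).image lo))
      ((Finset.univ.filter fun i => a i = 1).image fun i => -lo i) (by
        simp only [Finset.mem_insert, Finset.mem_image, Finset.mem_filter, Finset.mem_univ,
          true_and]
        rintro _ (rfl | ⟨j, hj, rfl⟩) _ ⟨i, hi, rfl⟩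
        · have := hP i hi
          simp only [lo]
          linarith
        · have := hPN i j hi hj
          simp only [lo]
          linarith)
    refine ⟨s, (hlo _ (Finset.mem_insert_self _ _)).le, fun i => ?_⟩
    rcases ha i with hi | hi | hi
    · have := hup _ (Finset.mem_image_of_mem _ (by simpa using hi))
      simp only [lo] at this
      rw [hi]
      linarith
    · have := hlo _ (Finset.mem_insert_of_mem (Finset.mem_image_of_mem lo (by simpa using hi)))
      simp only [lo] at this
      rw [hi]
      linarith
    · have := hZ i hi
      rw [hi]
      linarith

/-! ### Block matrices and aggregation -/

lemma quadForm_Q {f : QuadFun n} {a : ℝ} (ha : f.A = a • 1) (z : Fin n ⊕ Unit → ℝ) :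
    z ⬝ᵥ (f.Q *ᵥ z) = a * ((z ∘ Sum.inl) ⬝ᵥ (z ∘ Sum.inl)) +
      2 * z (Sum.inr ()) * (f.b ⬝ᵥ (z ∘ Sum.inl)) + f.c * z (Sum.inr ()) ^ 2 := by
  obtain ⟨y, w, rfl⟩ : ∃ y w, z = Sum.elim y w := ⟨_, _, (Sum.elim_comp_inl_inr z).symm⟩
  rw [Q, fromBlocks_mulVec, sumElim_dotProduct_sumElim]
  have h1 : replicateCol Unit f.b *ᵥ w = w () • f.b := by
    ext i; simp [mulVec, dotProduct, mul_comm]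
  have h2 : replicateRow Unit f.b *ᵥ y = fun _ => f.b ⬝ᵥ y := by
    ext i; simp [mulVec, dotProduct]
  simp [ha, smul_mulVec, h1, h2, dotProduct_comm y f.b]
  simp [dotProduct, mulVec]
  ring

lemma isHermitian_Q {f : QuadFun n} {a : ℝ} (ha : f.A = a • 1) : f.Q.IsHermitian := by
  ext i j
  rcases i with i | i <;> rcases j with j | j <;> simp [Q, ha, Matrix.one_apply, eq_comm]

lemma aggMatrix_quadForm (f : Fin m → QuadFun n) (l : Fin m → ℝ) (z : Fin n ⊕ Unit → ℝ) :
    z ⬝ᵥ (aggMatrix f l *ᵥ z) = ∑ i, l i * (z ⬝ᵥ ((f i).Q *ᵥ z)) := by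
  simp [aggMatrix, Matrix.sum_mulVec, dotProduct_sum, smul_mulVec]

/-- The quadratic form at `(y, w)` with `w ≠ 0` is `w²` times the aggregated function at `y / w`. At
`w = 0` only the leading coefficient matters, and it is nonnegative because `s` may tend to infinity
at `x = 0`. -/
lemma posSemidef_aggMatrix {f : Fin m → QuadFun n} {a : Fin m → ℝ}
    (ha : ∀ i, (f i).A = a i • 1) {l : Fin m → ℝ}
    (h : ∀ s x, x ⬝ᵥ x ≤ s → 0 ≤ ∑ i, l i * (f i).affineLift (a i) s x) :
    (aggMatrix f l).PosSemidef := by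
  have hsum : ∀ s x, ∑ i, l i * (f i).affineLift (a i) s x =
      (∑ i, l i * a i) * s + 2 * ∑ i, l i * ((f i).b ⬝ᵥ x) + ∑ i, l i * (f i).c := fun s x => by
    simp only [affineLift, Finset.sum_mul, Finset.mul_sum, ← Finset.sum_add_distrib]
    exact Finset.sum_congr rfl fun i _ => by ring
  have hlead : 0 ≤ ∑ i, l i * a i := by
    by_contra! hneg
    have h0 := h (|∑ i, l i * (f i).c| / -(∑ i, l i * a i) + 1) 0 (by
      have := div_nonneg (abs_nonneg (∑ i, l i * (f i).c)) (neg_nonneg.2 hneg.le)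
      simp only [dotProduct_zero]
      linarith)
    rw [hsum] at h0
    simp only [dotProduct_zero, mul_zero, Finset.sum_const_zero, add_zero] at h0
    have hcancel : (∑ i, l i * a i) * (|∑ i, l i * (f i).c| / -(∑ i, l i * a i)) =
        -|∑ i, l i * (f i).c| := by
      field_simp [hneg.ne]
    rw [mul_add, hcancel] at h0
    linarith [le_abs_self (∑ i, l i * (f i).c)]
  refine PosSemidef.of_dotProduct_mulVec_nonneg ?_ fun z => ?_
  · rw [aggMatrix, IsHermitian, conjTranspose_sum]
    exact Finset.sum_congr rfl fun i _ => by
      rw [conjTranspose_smul, (isHermitian_Q (ha i)).eq, star_trivial]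
  · rw [star_trivial, aggMatrix_quadForm]
    simp only [quadForm_Q (ha _)]
    set y := z ∘ Sum.inl
    set w := z (Sum.inr ())
    by_cases hw : w = 0
    · simp only [hw, mul_zero, zero_mul, add_zero, ne_eq, OfNat.ofNat_ne_zero, not_false_eq_true,
        zero_pow, ← mul_assoc, ← Finset.sum_mul]
      exact mul_nonneg hlead (dotProduct_self_nonneg_real y)
    · have h0 := mul_nonneg (sq_nonneg w) (h _ (w⁻¹ • y) le_rfl)
      rw [Finset.mul_sum] at h0
      refine h0.trans_eq (Finset.sum_congr rfl fun i _ => ?_)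
      simp only [affineLift, dotProduct_smul, smul_dotProduct, smul_eq_mul]
      field_simp

lemma aggregation_nonneg_of_posSemidef {f : Fin m → QuadFun n} {a : Fin m → ℝ}
    (ha : ∀ i, (f i).A = a i • 1) {l : Fin m → ℝ} (h : (aggMatrix f l).PosSemidef)
    (x : Fin n → ℝ) : 0 ≤ ∑ i, l i * (f i).eval x := by
  have h0 := h.dotProduct_mulVec_nonneg (Sum.elim x 1)
  rw [star_trivial, aggMatrix_quadForm] at h0
  refine h0.trans_eq (Finset.sum_congr rfl fun i _ => ?_)
  rw [quadForm_Q (ha i), eval_eq_affineLift (ha i)]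
  simp [affineLift]

/-! ### Multipliers by separation -/

/-- A theorem of the alternative for the lifted affine system. -/
lemma exists_multiplier_of_lift_infeasible {f : Fin m → QuadFun n} {a : Fin m → ℝ}
    (h : ¬ ∃ s x, x ⬝ᵥ x ≤ s ∧ ∀ i, (f i).affineLift (a i) s x < 0) :
    ∃ l : Fin m → ℝ, 0 ≤ l ∧ l ≠ 0 ∧
      ∀ s x, x ⬝ᵥ x ≤ s → 0 ≤ ∑ i, l i * (f i).affineLift (a i) s x := by
  -- `K` is convex, open and closed upwards, and `0 ∉ K` is exactly infeasibility.
  let K : Set (Fin m → ℝ) :=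
    {v | ∃ s x, x ⬝ᵥ x ≤ s ∧ ∀ i, (f i).affineLift (a i) s x < v i}
  have hconv : Convex ℝ K := by
    rintro v ⟨s, x, hs, hx⟩ w ⟨t, y, ht, hy⟩ p q hp hq hpq
    refine ⟨_, _, dotProduct_self_convexComb_le hs ht hp hq hpq, fun i => ?_⟩
    rw [affineLift_convexComb _ _ _ _ _ _ hpq]
    simp only [Pi.add_apply, Pi.smul_apply, smul_eq_mul]
    rcases hp.eq_or_lt with rfl | hp
    · obtain rfl : q = 1 := by linarith
      simpa using hy i
    · exact add_lt_add_of_lt_of_le (mul_lt_mul_of_pos_left (hx i) hp)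
        (mul_le_mul_of_nonneg_left (hy i).le hq)
  have hopen : IsOpen K := by
    have : K = ⋃ (s : ℝ) (x : Fin n → ℝ) (_ : x ⬝ᵥ x ≤ s),
        {v | ∀ i, (f i).affineLift (a i) s x < v i} := by
      ext v
      simp [K]
    rw [this]
    refine isOpen_iUnion fun s => isOpen_iUnion fun x => isOpen_iUnion fun _ => ?_
    simp only [Set.ofPred_forall]
    exact isOpen_iInter_of_finite fun i => isOpen_lt continuous_const (continuous_apply i)
  obtain ⟨g, hg⟩ := geometric_hahn_banach_point_open hconv hopen (x := 0) h
  have hg' : ∀ v, g v = ∑ i, g (Pi.single i 1) * v i := fun v => by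
    conv_lhs => rw [← Finset.univ_sum_single v, map_sum]
    refine Finset.sum_congr rfl fun i _ => ?_
    have : (Pi.single i (v i) : Fin m → ℝ) = v i • Pi.single i 1 := by
      rw [← Pi.single_smul, smul_eq_mul, mul_one]
    rw [this, map_smul, smul_eq_mul, mul_comm]
  simp only [map_zero] at hg
  have hray : ∀ s x, x ⬝ᵥ x ≤ s → ∀ d : Fin m → ℝ, (∀ i, 0 < d i) →
      0 < g (fun i => (f i).affineLift (a i) s x) + g d := fun s x hs d hd => by
    rw [← map_add]
    exact hg _ ⟨s, x, hs, fun i => by simp [hd i]⟩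
  refine ⟨fun i => g (Pi.single i 1), fun i => ?_, fun h0 => ?_, fun s x hs => ?_⟩
  -- A negative coefficient would make `g` negative far out along that coordinate.
  · by_contra! hneg
    simp only [Pi.zero_apply] at hneg
    have hr := fun r hr => hray 0 0 (by simp) (1 + r • Pi.single i 1) fun j =>
      show 0 < 1 + r * (Pi.single i 1 : Fin m → ℝ) j from
        add_pos_of_pos_of_nonneg one_pos (mul_nonneg hr ((Pi.single_nonneg.2 zero_le_one : (0 : Fin m → ℝ) ≤ Pi.single i 1) j))
    simp only [map_add, map_smul, smul_eq_mul] at hr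
    set e := g (Pi.single i 1)
    set d := g (fun i => (f i).affineLift (a i) 0 0) + g 1
    have h1 := hr (|d| / -e) (div_nonneg (abs_nonneg _) (by linarith))
    have h2 : |d| / -e * e = -|d| := by field_simp [hneg.ne]
    linarith [le_abs_self d]
  · have := hray 0 0 (by simp) 1 (fun _ => one_pos)
    rw [hg', hg' 1] at this
    have h1 : ∀ i, g (Pi.single i 1) = 0 := congrFun h0
    simp [h1] at this
  · rw [← hg']
    by_contra! hneg
    have hr := fun (r : ℝ) (hr : 0 < r) => hray s x hs (r • 1) fun i => by simpa using hr
    simp only [map_smul, smul_eq_mul] at hr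
    set e := g (fun i => (f i).affineLift (a i) s x)
    -- Slack `r • 1` with `r` small enough that `r * g 1 < -e`.
    have hpos : 0 < |g 1| + 1 := by positivity
    have h1 := hr (-e / (|g 1| + 1)) (div_pos (by linarith) hpos)
    have h2 : -e / (|g 1| + 1) * g 1 ≤ -e / (|g 1| + 1) * |g 1| :=
      mul_le_mul_of_nonneg_left (le_abs_self _) (div_pos (by linarith) hpos).le
    have h3 : -e / (|g 1| + 1) * |g 1| + -e / (|g 1| + 1) = -e := by
      field_simp
      ring
    have h4 : 0 < -e / (|g 1| + 1) := div_pos (by linarith) hpos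
    linarith

/-! ### Points violating a single constraint -/

/-- A quadratic function `|x|² + 2 bᵀ x + c` takes a nonnegative value. -/
lemma exists_affineLift_one_nonneg (hn : 0 < n) (f : QuadFun n) :
    ∃ x, 0 ≤ f.affineLift 1 (x ⬝ᵥ x) x := by
  let k : Fin n := ⟨0, hn⟩
  refine ⟨Pi.single k (2 * |f.b k| + |f.c| + 1), ?_⟩
  simp only [affineLift, dotProduct_single, Pi.single_eq_same, one_mul]
  have h1 := neg_abs_le (f.b k)
  have h2 := neg_abs_le f.c
  have h3 := abs_nonneg (f.b k)
  have h4 := abs_nonneg f.c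
  nlinarith [mul_nonneg h3 h4]

lemma exists_affineLift_zero_nonneg {f : QuadFun n} (h : f.b ≠ 0 ∨ (f.b = 0 ∧ 0 ≤ f.c)) :
    ∃ x, 0 ≤ f.affineLift 0 (x ⬝ᵥ x) x := by
  rcases h with hb | ⟨hb, hc⟩
  · have hpos := dotProduct_self_pos_real hb
    refine ⟨(|f.c| / (f.b ⬝ᵥ f.b)) • f.b, ?_⟩
    simp only [affineLift, dotProduct_smul, smul_eq_mul, zero_mul, zero_add]
    rw [div_mul_cancel₀ _ hpos.ne']
    linarith [neg_abs_le f.c, abs_nonneg f.c]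
  · exact ⟨0, by simpa [affineLift] using hc⟩

end QuadFun

/-! ### Assembly of the three statements -/

theorem mainTheorem7 {n m : ℕ} (f : Fin m → QuadFun n)
    (hA : ∀ i, (f i).A = 1 ∨ (f i).A = -1 ∨ (f i).A = 0)
    (hdim : QuadFun.spanDim f + 1 ≤ n ∨ (QuadFun.spanDim f = n ∧ QuadFun.PDLC f)) :
    (QuadFun.feasibleSet f = ∅ ↔
      ∃ l : Fin m → ℝ, 0 ≤ l ∧ l ≠ 0 ∧ (QuadFun.aggMatrix f l).PosSemidef) ∧
    (convexHull ℝ (QuadFun.feasibleSet f) ≠ Set.univ ↔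
      (QuadFun.idxP f).Nonempty ∨
        ∃ i ∈ QuadFun.idxZ f, (f i).b ≠ 0 ∨ ((f i).b = 0 ∧ 0 ≤ (f i).c)) ∧
    ((convexHull ℝ (QuadFun.feasibleSet f)).Nonempty →
      convexHull ℝ (QuadFun.feasibleSet f) ≠ Set.univ →
      ∃ L : Finset (Fin m → ℝ),
        (∀ l ∈ L, 0 ≤ l ∧ l ≠ 0) ∧
        L.card ≤ (QuadFun.idxP f).ncard * (QuadFun.idxN f).ncard
          + (QuadFun.idxP f).ncard + (QuadFun.idxZ f).ncard ∧
        convexHull ℝ (QuadFun.feasibleSet f) = ⋂ l ∈ L, QuadFun.aggSet f l) := by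
  -- For `n = 0` there is no nonzero `u`. With `n > 0` a diagonal entry tells `I`, `-I` and `0`
  -- apart.
  have hn : 0 < n := by
    rcases Nat.eq_zero_or_pos n with rfl | h
    · have ha : ∀ i, (f i).A = (0 : ℝ) • 1 := fun i => Subsingleton.elim _ _
      obtain ⟨σ, u, hu, -⟩ := QuadFun.exists_constant_direction ha hdim
      exact absurd (Subsingleton.elim u 0) hu
    · exact h
  let k : Fin n := ⟨0, hn⟩
  obtain ⟨a, ha, hcases⟩ : ∃ a : Fin m → ℝ, (∀ i, (f i).A = a i • 1) ∧
      ∀ i, a i = 1 ∨ a i = -1 ∨ a i = 0 := by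
    refine ⟨fun i => (f i).A k k, fun i => ?_, fun i => ?_⟩ <;>
      rcases hA i with h | h | h <;> simp [h]
  have hval : ∀ i, (f i).A k k = a i := fun i => by simp [ha i]
  have hP : QuadFun.idxP f = {i | a i = 1} := by
    ext i
    refine ⟨fun h => ?_, fun h => ?_⟩
    · have h' : (f i).A = 1 := h
      simpa [h'] using (hval i).symm
    · have h' : a i = 1 := h
      simp [QuadFun.idxP, ha i, h']
  have hN : QuadFun.idxN f = {i | a i = -1} := by
    ext i
    refine ⟨fun h => ?_, fun h => ?_⟩
    · have h' : (f i).A = -1 := h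
      simpa [h'] using (hval i).symm
    · have h' : a i = -1 := h
      simp [QuadFun.idxN, ha i, h']
  have hZ : QuadFun.idxZ f = {i | a i = 0} := by
    ext i
    refine ⟨fun h => ?_, fun h => ?_⟩
    · have h' : (f i).A = 0 := h
      simpa [h'] using (hval i).symm
    · have h' : a i = 0 := h
      simp [QuadFun.idxZ, ha i, h']
  have hhull := QuadFun.convexHull_feasibleSet_eq ha hdim
  have hmem : ∀ x, x ∈ convexHull ℝ (QuadFun.feasibleSet f) ↔
      (∀ i, a i = 1 → (f i).affineLift 1 (x ⬝ᵥ x) x < 0) ∧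
      (∀ i, a i = 0 → (f i).affineLift 0 (x ⬝ᵥ x) x < 0) ∧
      ∀ i j, a i = 1 → a j = -1 →
        (f i).affineLift 1 (x ⬝ᵥ x) x + (f j).affineLift (-1) (x ⬝ᵥ x) x < 0 := fun x => by
    rw [hhull]
    exact QuadFun.exists_lift_iff hcases x
  refine ⟨⟨fun hS => ?_, ?_⟩, ?_, fun _ _ => ?_⟩
  · rw [hS, convexHull_empty] at hhull
    obtain ⟨l, hl, hl0, h⟩ := QuadFun.exists_multiplier_of_lift_infeasible (f := f) (a := a) (by
      rintro ⟨s, x, h⟩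
      exact (Set.ext_iff.1 hhull x).2 ⟨s, h⟩)
    exact ⟨l, hl, hl0, QuadFun.posSemidef_aggMatrix ha h⟩
  · rintro ⟨l, hl, hl0, h⟩
    refine Set.eq_empty_of_forall_notMem fun x hx => ?_
    obtain ⟨i, hi⟩ := Function.ne_iff.1 hl0
    refine (QuadFun.aggregation_nonneg_of_posSemidef ha h x).not_gt
      (Finset.sum_neg' (fun j _ => mul_nonpos_of_nonneg_of_nonpos (hl j) (hx j).le)
        ⟨i, Finset.mem_univ i, mul_neg_of_pos_of_neg (lt_of_le_of_ne (hl i) hi.symm) (hx i)⟩)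
  · rw [Set.ne_univ_iff_exists_notMem, hP, hZ]
    constructor
    · rintro ⟨x, hx⟩
      by_contra! hcon
      obtain ⟨hPe, hZe⟩ := hcon
      rw [Set.eq_empty_iff_forall_notMem] at hPe
      refine hx ((hmem x).2 ⟨fun i hi => absurd hi (hPe i), fun i hi => ?_,
        fun i _ hi => absurd hi (hPe i)⟩)
      obtain ⟨hb, hc⟩ := hZe i hi
      simpa [QuadFun.affineLift, hb] using hc hb
    · rintro (⟨i, hi⟩ | ⟨i, hi, h⟩)
      · obtain ⟨x, hx⟩ := QuadFun.exists_affineLift_one_nonneg hn (f i)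
        exact ⟨x, fun h => hx.not_gt (((hmem x).1 h).1 i hi)⟩
      · obtain ⟨x, hx⟩ := QuadFun.exists_affineLift_zero_nonneg h
        exact ⟨x, fun h => hx.not_gt (((hmem x).1 h).2.1 i hi)⟩
  · classical
    let P := Finset.univ.filter fun i => a i = 1
    let N := Finset.univ.filter fun i => a i = -1
    let Z := Finset.univ.filter fun i => a i = 0
    let e : Fin m → Fin m → ℝ := fun i => Pi.single i 1
    have he : ∀ i, 0 ≤ e i := fun i => Pi.single_nonneg.2 zero_le_one
    have he1 : ∀ i, e i i = 1 := fun i => Pi.single_eq_same i 1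
    have hesum : ∀ i x, ∑ j, e i j * (f j).eval x = (f i).eval x := fun i x => by
      simp [e, Pi.single_apply]
    -- Unit weights keep a constraint of `P` or `Z`; `e i + e j` cancels the quadratic terms of a
    -- `P`–`N` pair.
    refine ⟨(P ×ˢ N).image (fun p => e p.1 + e p.2) ∪ P.image e ∪ Z.image e, ?_, ?_, ?_⟩
    · have hpos : ∀ l : Fin m → ℝ, ∀ i, 0 < l i → l ≠ 0 := by
        rintro l i h rfl
        exact lt_irrefl _ h
      intro l hl
      simp only [Finset.mem_union, Finset.mem_image] at hl
      rcases hl with (⟨p, -, rfl⟩ | ⟨i, -, rfl⟩) | ⟨i, -, rfl⟩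
      · refine ⟨add_nonneg (he _) (he _), hpos _ p.1 ?_⟩
        rw [Pi.add_apply, he1]
        exact add_pos_of_pos_of_nonneg one_pos (he p.2 p.1)
      · exact ⟨he i, hpos _ i (by simp [he1])⟩
      · exact ⟨he i, hpos _ i (by simp [he1])⟩
    · have hcard : ∀ r : ℝ, {i | a i = r}.ncard = (Finset.univ.filter fun i => a i = r).card :=
        fun r => by rw [← Set.ncard_coe_finset]; simp
      rw [hP, hN, hZ, hcard, hcard, hcard, ← Finset.card_product]
      exact (Finset.card_union_le _ _).trans (add_le_add ((Finset.card_union_le _ _).trans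
        (add_le_add Finset.card_image_le Finset.card_image_le)) Finset.card_image_le)
    · have hev : ∀ i r x, a i = r → (f i).eval x = (f i).affineLift r (x ⬝ᵥ x) x :=
        fun i r x h => h ▸ QuadFun.eval_eq_affineLift (ha i) x
      ext x
      rw [hmem x]
      simp only [Set.mem_iInter, QuadFun.aggSet, Set.mem_ofPred_eq]
      constructor
      · rintro ⟨h1, h2, h3⟩ l hl
        simp only [Finset.mem_union, Finset.mem_image, Finset.mem_product, P, N, Z,
          Finset.mem_filter, Finset.mem_univ, true_and] at hl
        rcases hl with (⟨p, ⟨hp, hq⟩, rfl⟩ | ⟨i, hi, rfl⟩) | ⟨i, hi, rfl⟩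
        · simp only [Pi.add_apply, add_mul, Finset.sum_add_distrib, hesum]
          rw [hev _ _ x hp, hev _ _ x hq]
          exact h3 _ _ hp hq
        · rw [hesum, hev _ _ x hi]
          exact h1 i hi
        · rw [hesum, hev _ _ x hi]
          exact h2 i hi
      · intro h
        refine ⟨fun i hi => ?_, fun i hi => ?_, fun i j hi hj => ?_⟩
        · rw [← hev i _ x hi, ← hesum]
          exact h _ (Finset.mem_union_left _ (Finset.mem_union_right _
            (Finset.mem_image_of_mem _ (by simpa [P] using hi))))
        · rw [← hev i _ x hi, ← hesum]
          exact h _ (Finset.mem_union_right _ (Finset.mem_image_of_mem _ (by simpa [Z] using hi)))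
        · rw [← hev i _ x hi, ← hev j _ x hj, ← hesum i, ← hesum j, ← Finset.sum_add_distrib]
          simp only [← add_mul]
          exact h _ (Finset.mem_union_left _ (Finset.mem_union_left _
            (Finset.mem_image_of_mem (fun p : Fin m × Fin m => e p.1 + e p.2) (a := (i, j))
              (by simp [P, N, hi, hj]))))
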